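/- Let $\mathcal H$ be a separable complex Hilbert space, $T$ a positive (possibly unbounded) self-adjoint operator on $\mathcal H$, $(\Omega,\Sigma,\mu)$ a $\sigma$-finite measure space, and $P:\Sigma\to\mathcal B(\mathcal H)$ a projection-valued measure with $P(S)=0$ whenever $\mu(S)=0$. Let $\mathcal S_1^+$ be the set of positive trace-class operators on $\mathcal H$. For $\gamma\in\mathcal S_1^+$ put $\operatorname{Tr}(T\gamma):=\sup_{\varepsilon>0}\operatorname{Tr}(T(1+\varepsilon T)^{-1}\gamma)\in[0,\infty]$ and $\operatorname{Tr}((1+T)\gamma):=\operatorname{Tr}\gamma+\operatorname{Tr}(T\gamma)$. Let $$X:=\{\gamma^+-\gamma^-\mid \gamma^\pm\in\mathcal S_1^+,\ \operatorname{Tr}(T\gamma^\pm)<\infty\},$$ $$\|\gamma\|_X:=\inf\{\operatorname{Tr}((1+T)\gamma^+)+\operatorname{Tr}((1+T)\gamma^-)\mid \gamma^\pm\in\mathcal S_1^+,\ \gamma=\gamma^+-\gamma^-\}.$$ Let $D:X\to L^1_{\mathbb R}(\Omega,\mu)$ be the linear map sending $\gamma$ to the Radon--Nikodym derivative with respect to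 $\mu$ of the signed measure $S\mapsto\operatorname{Tr}(P(S)\gamma)$, i.e. $\int_S D\gamma\,d\mu=\operatorname{Tr}(P(S)\gamma)$ for all $S\in\Sigma$. Let $\Xi:=D(X)$ and, for $\rho\in\Xi$, $$\|\rho\|_\Xi:=\inf\{\|\gamma\|_X\mid\gamma\in X,\ D\gamma=\rho\}.$$ Then $\|\cdot\|_X$ is a norm on $X$, $\|\cdot\|_\Xi$ is a norm on $\Xi$, and $\Xi$ is complete with respect to $\|\cdot\|_\Xi$, i.e. $\Xi$ is a real Banach space. Moreover, the map $[\gamma]\mapsto D\gamma$ is a well-defined linear isometric isomorphism of $X/\ker D$, with the quotient norm of $\|\cdot\|_X$, onto $(\Xi,\|\cdot\|_\Xi)$. -/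

import Mathlib

set_option linter.unusedSectionVars false

open MeasureTheory
open scoped ENNReal InnerProductSpace

namespace DensityFunctional

noncomputable section

section Trace

variable {H : Type*} [NormedAddCommGroup H] [InnerProductSpace ℂ H] [CompleteSpace H]

/-! ### Traces and trace-class operators -/

/-- Index set of a fixed orthonormal (Hilbert) basis of `H`. -/
def basisIndex (H : Type*) [NormedAddCommGroup H] [InnerProductSpace ℂ H] [CompleteSpace H] :
    Set H :=
  (exists_hilbertBasis ℂ H).choose

/-- A fixed orthonormal (Hilbert) basis of `H`, used to compute traces. -/
def stdBasis (H : Type*) [NormedAddCommGroup H] [InnerProductSpace ℂ H] [CompleteSpace H] :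
    HilbertBasis (basisIndex H) ℂ H :=
  (exists_hilbertBasis ℂ H).choose_spec.choose

/-- The trace `∑ ⟨e, A e⟩ ∈ [0, ∞]` of a positive bounded operator. -/
def posTrace (A : H →L[ℂ] H) : ℝ≥0∞ :=
  ∑' i, ENNReal.ofReal (⟪stdBasis H i, A (stdBasis H i)⟫_ℂ).re

/-- The trace `∑ ⟨e, A e⟩` of a trace-class operator. -/
def trace (A : H →L[ℂ] H) : ℂ :=
  ∑' i, ⟪stdBasis H i, A (stdBasis H i)⟫_ℂ

/-- `A` is trace class: `Tr |A| < ∞`. -/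
def IsTraceClass (A : H →L[ℂ] H) : Prop := posTrace (CFC.abs A) < ∞

/-- The positive trace-class operators. -/
def posTraceClass (H : Type*) [NormedAddCommGroup H] [InnerProductSpace ℂ H] [CompleteSpace H] :
    Set (H →L[ℂ] H) :=
  {γ | 0 ≤ γ ∧ IsTraceClass γ}

/-! Elementary facts on traces. -/

lemma re_inner_nonneg {A : H →L[ℂ] H} (hA : 0 ≤ A) (x : H) : 0 ≤ (⟪x, A x⟫_ℂ).re :=
  ((ContinuousLinearMap.nonneg_iff_isPositive A).1 hA).re_inner_nonneg_right x

lemma mem_posTraceClass {γ : H →L[ℂ] H} : γ ∈ posTraceClass H ↔ 0 ≤ γ ∧ posTrace γ < ∞ := by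
  unfold posTraceClass IsTraceClass
  constructor
  · rintro ⟨h, h'⟩
    exact ⟨h, by rwa [CFC.abs_of_nonneg γ h] at h'⟩
  · rintro ⟨h, h'⟩
    exact ⟨h, by rwa [CFC.abs_of_nonneg γ h]⟩

lemma posTrace_add {A B : H →L[ℂ] H} (hA : 0 ≤ A) (hB : 0 ≤ B) :
    posTrace (A + B) = posTrace A + posTrace B := by
  unfold posTrace
  rw [← ENNReal.tsum_add]
  refine tsum_congr fun i => ?_
  rw [← ENNReal.ofReal_add (re_inner_nonneg hA _) (re_inner_nonneg hB _)]
  simp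

lemma posTrace_smul {c : ℝ} (hc : 0 ≤ c) (A : H →L[ℂ] H) :
    posTrace (c • A) = ENNReal.ofReal c * posTrace A := by
  unfold posTrace
  rw [← ENNReal.tsum_mul_left]
  refine tsum_congr fun i => ?_
  rw [← ENNReal.ofReal_mul hc]
  simp [inner_smul_right_eq_smul]

lemma posTrace_zero : posTrace (0 : H →L[ℂ] H) = 0 := by simp [posTrace]

lemma add_mem_posTraceClass {A B : H →L[ℂ] H} (hA : A ∈ posTraceClass H)
    (hB : B ∈ posTraceClass H) : A + B ∈ posTraceClass H := by
  rw [mem_posTraceClass] at *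
  refine ⟨add_nonneg hA.1 hB.1, ?_⟩
  rw [posTrace_add hA.1 hB.1]
  exact ENNReal.add_lt_top.2 ⟨hA.2, hB.2⟩

lemma smul_mem_posTraceClass {c : ℝ} (hc : 0 ≤ c) {A : H →L[ℂ] H} (hA : A ∈ posTraceClass H) :
    c • A ∈ posTraceClass H := by
  rw [mem_posTraceClass] at *
  refine ⟨smul_nonneg hc hA.1, ?_⟩
  rw [posTrace_smul hc]
  exact ENNReal.mul_lt_top ENNReal.ofReal_lt_top hA.2

lemma zero_mem_posTraceClass : (0 : H →L[ℂ] H) ∈ posTraceClass H := by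
  rw [mem_posTraceClass]
  simp [posTrace_zero]

/-- Parseval's identity in `[0, ∞]`. -/
lemma tsum_enorm_inner {ι : Type*} (b : HilbertBasis ι ℂ H) (x : H) :
    ∑' i, ‖⟪b i, x⟫_ℂ‖ₑ ^ 2 = ‖x‖ₑ ^ 2 := by
  have h := b.hasSum_inner_mul_inner x x
  have h2 : HasSum (fun i => ‖⟪b i, x⟫_ℂ‖ ^ 2) (‖x‖ ^ 2) := by
    have h3 := Complex.hasSum_re h
    convert h3 using 1
    · funext i
      rw [← inner_conj_symm x (b i), mul_comm, Complex.mul_conj, Complex.normSq_eq_norm_sq,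
        Complex.ofReal_re]
    · exact (inner_self_eq_norm_sq (𝕜 := ℂ) x).symm
  have h4 := ENNReal.ofReal_tsum_of_nonneg (fun i => by positivity) h2.summable
  rw [h2.tsum_eq] at h4
  simp only [ENNReal.ofReal_pow (norm_nonneg _), ofReal_norm] at h4
  exact h4.symm

/-- The squared Hilbert–Schmidt norm of an operator and of its adjoint agree, in any bases. -/
lemma tsum_enorm_adjoint {ι κ : Type*} (b : HilbertBasis ι ℂ H) (c : HilbertBasis κ ℂ H)
    (A : H →L[ℂ] H) :
    ∑' i, ‖A (b i)‖ₑ ^ 2 = ∑' j, ‖A.adjoint (c j)‖ₑ ^ 2 := by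
  simp_rw [← tsum_enorm_inner c (A (b _)), ← tsum_enorm_inner b (A.adjoint _)]
  rw [ENNReal.tsum_comm]
  refine tsum_congr fun j => tsum_congr fun i => ?_
  rw [ContinuousLinearMap.adjoint_inner_right, ← ofReal_norm, ← ofReal_norm, norm_inner_symm]

lemma exists_sqrt {γ : H →L[ℂ] H} (h : 0 ≤ γ) :
    ∃ s : H →L[ℂ] H, s.adjoint = s ∧ s ∘L s = γ :=
  ⟨CFC.sqrt γ, (CFC.sqrt_nonneg γ).star_eq, CFC.sqrt_mul_sqrt_self γ h⟩

lemma tsum_enorm_sqrt {ι : Type*} (b : HilbertBasis ι ℂ H) {γ s : H →L[ℂ] H}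
    (hs : s.adjoint = s) (hγ : s ∘L s = γ) :
    ∑' i, ENNReal.ofReal (⟪b i, γ (b i)⟫_ℂ).re = ∑' i, ‖s (b i)‖ₑ ^ 2 := by
  refine tsum_congr fun i => ?_
  have : ⟪b i, γ (b i)⟫_ℂ = ⟪s (b i), s (b i)⟫_ℂ := by
    rw [← hγ, ContinuousLinearMap.comp_apply]
    nth_rw 1 [← hs]
    rw [ContinuousLinearMap.adjoint_inner_right]
  rw [this]
  have h2 : (⟪s (b i), s (b i)⟫_ℂ).re = ‖s (b i)‖ ^ 2 := inner_self_eq_norm_sq (𝕜 := ℂ) _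
  rw [h2, ENNReal.ofReal_pow (norm_nonneg _), ofReal_norm]

/-- The trace of a positive operator does not depend on the orthonormal basis. -/
theorem posTrace_eq {ι : Type*} (b : HilbertBasis ι ℂ H) {γ : H →L[ℂ] H} (h : 0 ≤ γ) :
    posTrace γ = ∑' i, ENNReal.ofReal (⟪b i, γ (b i)⟫_ℂ).re := by
  obtain ⟨s, hs, hγ⟩ := exists_sqrt h
  unfold posTrace
  rw [tsum_enorm_sqrt _ hs hγ, tsum_enorm_sqrt _ hs hγ, tsum_enorm_adjoint _ b, hs]

lemma summable_inner_of_hs {ι : Type*} {f g : ι → H} (hf : ∑' i, ‖f i‖ₑ ^ 2 < ∞)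
    (hg : ∑' i, ‖g i‖ₑ ^ 2 < ∞) : Summable fun i => ⟪f i, g i⟫_ℂ := by
  have key : ∀ f : ι → H, ∑' i, ‖f i‖ₑ ^ 2 < ∞ → Summable fun i => ‖f i‖ ^ 2 := by
    intro f hf
    have := ENNReal.summable_toReal hf.ne
    simpa using this
  refine Summable.of_norm_bounded ((key f hf).add (key g hg)) fun i => ?_
  refine (norm_inner_le_norm _ _).trans ?_
  nlinarith [sq_nonneg (‖f i‖ - ‖g i‖), sq_nonneg (‖f i‖), sq_nonneg (‖g i‖)]

lemma hs_comp_lt_top (A s : H →L[ℂ] H) {ι : Type*} (b : HilbertBasis ι ℂ H)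
    (h : ∑' i, ‖s (b i)‖ₑ ^ 2 < ∞) : ∑' i, ‖(A ∘L s) (b i)‖ₑ ^ 2 < ∞ := by
  refine lt_of_le_of_lt (ENNReal.tsum_le_tsum
    (g := fun i => ‖A‖ₑ ^ 2 * ‖s (b i)‖ₑ ^ 2) fun i => ?_) ?_
  · rw [← mul_pow]
    gcongr
    exact A.le_opENorm _
  · rw [ENNReal.tsum_mul_left]
    exact ENNReal.mul_lt_top (by simp) h

/-- If `γ` is positive and trace class and `A` is bounded, the series for `Tr (A γ)` converges. -/
lemma summable_trace {γ : H →L[ℂ] H} (hγ : γ ∈ posTraceClass H) (A : H →L[ℂ] H) :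
    Summable fun i => ⟪stdBasis H i, (A ∘L γ) (stdBasis H i)⟫_ℂ := by
  rw [mem_posTraceClass] at hγ
  obtain ⟨s, hs, h⟩ := exists_sqrt hγ.1
  have h1 : ∑' i, ‖s (stdBasis H i)‖ₑ ^ 2 < ∞ := by
    rw [← tsum_enorm_sqrt _ hs h]; exact hγ.2
  have h2 : ∑' i, ‖(s ∘L A.adjoint) (stdBasis H i)‖ₑ ^ 2 < ∞ := by
    rw [tsum_enorm_adjoint _ (stdBasis H), ContinuousLinearMap.adjoint_comp,
      ContinuousLinearMap.adjoint_adjoint, hs]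
    exact hs_comp_lt_top A s _ h1
  refine (summable_inner_of_hs h2 h1).congr fun i => ?_
  rw [ContinuousLinearMap.comp_apply, ← h, ContinuousLinearMap.comp_apply,
    ContinuousLinearMap.comp_apply, ← ContinuousLinearMap.adjoint_inner_left A]
  nth_rw 1 [← hs]
  rw [ContinuousLinearMap.adjoint_inner_left]

lemma trace_comp_add {γ γ' : H →L[ℂ] H} (hγ : γ ∈ posTraceClass H) (hγ' : γ' ∈ posTraceClass H)
    (A : H →L[ℂ] H) : trace (A ∘L (γ + γ')) = trace (A ∘L γ) + trace (A ∘L γ') := by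
  unfold trace
  rw [← (summable_trace hγ A).tsum_add (summable_trace hγ' A)]
  simp

lemma trace_comp_sub {γ γ' : H →L[ℂ] H} (hγ : γ ∈ posTraceClass H) (hγ' : γ' ∈ posTraceClass H)
    (A : H →L[ℂ] H) : trace (A ∘L (γ - γ')) = trace (A ∘L γ) - trace (A ∘L γ') := by
  unfold trace
  rw [← (summable_trace hγ A).tsum_sub (summable_trace hγ' A)]
  simp

lemma trace_comp_smul (c : ℝ) (γ A : H →L[ℂ] H) :
    trace (A ∘L (c • γ)) = c * trace (A ∘L γ) := by
  unfold trace
  rw [← tsum_mul_left]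
  simp [inner_smul_right_eq_smul]

/-- Cyclicity: `Tr (B* A) = Tr (A B*)` for Hilbert–Schmidt operators `A`, `B`. -/
lemma tsum_inner_adjoint (b : HilbertBasis (basisIndex H) ℂ H) {A B : H →L[ℂ] H}
    (hA : ∑' i, ‖A (b i)‖ₑ ^ 2 < ∞) (hB : ∑' i, ‖B (b i)‖ₑ ^ 2 < ∞) :
    ∑' i, ⟪B (b i), A (b i)⟫_ℂ = ∑' j, ⟪A.adjoint (b j), B.adjoint (b j)⟫_ℂ := by
  have key : ∀ A : H →L[ℂ] H, ∑' i, ‖A (b i)‖ₑ ^ 2 < ∞ →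
      Summable fun p : basisIndex H × basisIndex H => ‖⟪b p.2, A (b p.1)⟫_ℂ‖ ^ 2 := by
    intro A hA
    have h : ∑' p : basisIndex H × basisIndex H, ‖⟪b p.2, A (b p.1)⟫_ℂ‖ₑ ^ 2 ≠ ∞ := by
      rw [ENNReal.tsum_prod (f := fun i j => ‖⟪b j, A (b i)⟫_ℂ‖ₑ ^ 2)]
      simp_rw [tsum_enorm_inner]
      exact hA.ne
    refine (ENNReal.summable_toReal h).congr fun p => ?_
    rw [ENNReal.toReal_pow, toReal_enorm]
  have hs : Summable fun p : basisIndex H × basisIndex H =>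
      ⟪B (b p.1), b p.2⟫_ℂ * ⟪b p.2, A (b p.1)⟫_ℂ := by
    refine Summable.of_norm_bounded ((key A hA).add (key B hB)) fun p => ?_
    rw [norm_mul, norm_inner_symm]
    nlinarith [sq_nonneg (‖⟪b p.2, A (b p.1)⟫_ℂ‖ - ‖⟪b p.2, B (b p.1)⟫_ℂ‖),
      sq_nonneg ‖⟪b p.2, A (b p.1)⟫_ℂ‖, sq_nonneg ‖⟪b p.2, B (b p.1)⟫_ℂ‖]
  rw [tsum_congr fun i => (b.tsum_inner_mul_inner (B (b i)) (A (b i))).symm,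
    tsum_congr fun j => (b.tsum_inner_mul_inner (A.adjoint (b j)) (B.adjoint (b j))).symm]
  rw [← Summable.tsum_comm (f := fun i j => ⟪B (b i), b j⟫_ℂ * ⟪b j, A (b i)⟫_ℂ) hs]
  refine tsum_congr fun j => tsum_congr fun i => ?_
  rw [ContinuousLinearMap.adjoint_inner_right, ContinuousLinearMap.adjoint_inner_left, mul_comm]

end Trace

section Kinetic

variable {H : Type*} [NormedAddCommGroup H] [InnerProductSpace ℂ H] [CompleteSpace H]

/-! ### Positive unbounded operators and the kinetic energy functional -/

/-- `T` is a positive (possibly unbounded) operator: self-adjoint with `⟨ψ, T ψ⟩ ≥ 0` on its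
domain. -/
def IsPositiveSelfAdjoint (T : H →ₗ.[ℂ] H) : Prop :=
  IsSelfAdjoint T ∧ ∀ ψ : T.domain, 0 ≤ (⟪(ψ : H), T ψ⟫_ℂ).re

open Classical in
/-- The bounded operator `T_ε = T (1 + ε T)⁻¹`, i.e. the one with `T_ε (φ + ε T φ) = T φ` for all
`φ` in the domain of `T`. For positive self-adjoint `T` and `ε > 0` it exists and is unique, see
`regularized_apply` and `regularized_unique`. -/
def regularized (T : H →ₗ.[ℂ] H) (ε : ℝ) : H →L[ℂ] H :=
  if h : ∃ A : H →L[ℂ] H, ∀ φ : T.domain, A ((φ : H) + ε • T φ) = T φ then h.choose else 0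

lemma norm_le_of_positive {T : H →ₗ.[ℂ] H} (hT : IsPositiveSelfAdjoint T) {ε : ℝ} (hε : 0 < ε)
    (φ : T.domain) : ‖(φ : H)‖ ≤ ‖(φ : H) + ε • T φ‖ := by
  by_cases h0 : ‖(φ : H)‖ = 0
  · rw [h0]; positivity
  have h1 : ‖(φ : H)‖ ^ 2 ≤ (⟪(φ : H), (φ : H) + ε • T φ⟫_ℂ).re := by
    rw [inner_add_right, inner_smul_right_eq_smul, Complex.add_re, Complex.smul_re, smul_eq_mul]
    have h2 : (⟪(φ : H), (φ : H)⟫_ℂ).re = ‖(φ : H)‖ ^ 2 := inner_self_eq_norm_sq (𝕜 := ℂ) _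
    have := mul_nonneg hε.le (hT.2 φ)
    linarith
  have h3 := h1.trans ((Complex.re_le_norm _).trans (norm_inner_le_norm _ _))
  have h4 : 0 < ‖(φ : H)‖ := lt_of_le_of_ne (norm_nonneg _) (Ne.symm h0)
  nlinarith

/-- `1 + ε T` maps the domain of `T` onto `H`. -/
theorem surjective_one_add {T : H →ₗ.[ℂ] H} (hT : IsPositiveSelfAdjoint T) {ε : ℝ} (hε : 0 < ε)
    (ψ : H) : ∃ φ : T.domain, (φ : H) + ε • T φ = ψ := by
  let L : T.domain →ₗ[ℂ] H := T.domain.subtype + (ε : ℂ) • T.toFun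
  have hL : ∀ φ : T.domain, L φ = (φ : H) + ε • T φ := fun φ => by
    simp [L]
  have hclosed : IsClosed (LinearMap.range L : Set H) := by
    refine IsSeqClosed.isClosed ?_
    intro u y hu huy
    choose φ hφ using hu
    have hcau : CauchySeq fun n => (φ n : H) := by
      have hc := huy.cauchySeq
      rw [Metric.cauchySeq_iff] at hc ⊢
      intro δ hδ
      obtain ⟨N, hN⟩ := hc δ hδ
      refine ⟨N, fun m hm n hn => lt_of_le_of_lt ?_ (hN m hm n hn)⟩
      rw [dist_eq_norm, dist_eq_norm, ← hφ m, ← hφ n, ← map_sub, hL]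
      exact norm_le_of_positive hT hε (φ m - φ n)
    obtain ⟨x, hx⟩ := cauchySeq_tendsto_of_complete hcau
    have hTx : Filter.Tendsto (fun n => T (φ n)) Filter.atTop (nhds (ε⁻¹ • (y - x))) := by
      have : (fun n => T (φ n)) = fun n => ε⁻¹ • (u n - (φ n : H)) := by
        funext n
        rw [← hφ n, hL, add_sub_cancel_left, smul_smul, inv_mul_cancel₀ hε.ne', one_smul]
      rw [this]
      exact (huy.sub hx).const_smul _
    have hg : (x, ε⁻¹ • (y - x)) ∈ T.graph :=
      hT.1.isClosed.isSeqClosed (x := fun n => ((φ n : H), T (φ n)))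
        (fun n => T.mem_graph (φ n)) (hx.prodMk_nhds hTx)
    rw [LinearPMap.mem_graph_iff] at hg
    obtain ⟨z, hz1, hz2⟩ := hg
    refine ⟨z, ?_⟩
    rw [hL, hz2, smul_smul, mul_inv_cancel₀ hε.ne', one_smul]
    simp only at hz1
    rw [hz1]
    abel
  have horth : (LinearMap.range L)ᗮ = ⊥ := by
    rw [Submodule.eq_bot_iff]
    intro y hy
    rw [Submodule.mem_orthogonal'] at hy
    have hy' : ∀ x : T.domain, ⟪-(ε⁻¹ • y), (x : H)⟫_ℂ = ⟪y, T x⟫_ℂ := by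
      intro x
      have h := hy (L x) ⟨x, rfl⟩
      rw [hL, inner_add_right, inner_smul_right_eq_smul] at h
      rw [inner_neg_left, inner_smul_left_eq_smul, eq_neg_of_add_eq_zero_left h, smul_neg,
        neg_neg, smul_smul, inv_mul_cancel₀ hε.ne', one_smul]
    have hdom : y ∈ T.adjoint.domain := T.mem_adjoint_domain_of_exists y ⟨_, hy'⟩
    have happ : T.adjoint ⟨y, hdom⟩ = -(ε⁻¹ • y) :=
      LinearPMap.adjoint_apply_eq hT.1.dense_domain ⟨y, hdom⟩ hy'
    have hsa : T.adjoint = T := hT.1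
    have hdom' : y ∈ T.domain := by rw [← hsa]; exact hdom
    have happ' : T ⟨y, hdom'⟩ = -(ε⁻¹ • y) := by
      rw [← happ]
      have := hsa.le.2 (x := ⟨y, hdom⟩) (y := ⟨y, hdom'⟩) rfl
      exact this.symm
    have h := norm_le_of_positive hT hε ⟨y, hdom'⟩
    rw [happ', smul_neg, smul_smul, mul_inv_cancel₀ hε.ne', one_smul, add_neg_cancel,
      norm_zero] at h
    exact norm_le_zero_iff.1 h
  have hc : (LinearMap.range L) = ⊤ := by
    have : CompleteSpace (LinearMap.range L) := hclosed.completeSpace_coe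
    exact (Submodule.orthogonal_eq_bot_iff).1 horth
  obtain ⟨φ, hφ⟩ := LinearMap.range_eq_top.1 hc ψ
  exact ⟨φ, by rw [← hL, hφ]⟩

/-- The defining equation of `T_ε` holds for positive self-adjoint `T`. -/
theorem regularized_apply {T : H →ₗ.[ℂ] H} (hT : IsPositiveSelfAdjoint T) {ε : ℝ} (hε : 0 < ε)
    (φ : T.domain) : regularized T ε ((φ : H) + ε • T φ) = T φ := by
  have hex : ∃ A : H →L[ℂ] H, ∀ φ : T.domain, A ((φ : H) + ε • T φ) = T φ := by
    choose R hR using surjective_one_add hT hε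
    have inj : ∀ φ φ' : T.domain, (φ : H) + ε • T φ = (φ' : H) + ε • T φ' → φ = φ' := by
      intro φ φ' h
      have h1 := norm_le_of_positive hT hε (φ - φ')
      have h2 : ((φ - φ' : T.domain) : H) + ε • T (φ - φ') = 0 := by
        rw [LinearPMap.map_sub, smul_sub, Submodule.coe_sub]
        rw [← sub_eq_zero] at h
        rw [← h]; abel
      rw [h2, norm_zero, norm_le_zero_iff] at h1
      exact sub_eq_zero.1 (Subtype.ext h1)
    let R' : H →ₗ[ℂ] H :=
      { toFun := fun ψ => (R ψ : H)
        map_add' := fun x y => by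
          rw [← Submodule.coe_add]
          congr 1
          apply inj
          rw [hR, LinearPMap.map_add, Submodule.coe_add, smul_add]
          nth_rw 1 [← hR x, ← hR y]
          abel
        map_smul' := fun c x => by
          rw [RingHom.id_apply, ← Submodule.coe_smul]
          congr 1
          apply inj
          rw [hR, LinearPMap.map_smul, Submodule.coe_smul, smul_comm, ← smul_add, hR] }
    let R'' : H →L[ℂ] H := R'.mkContinuous 1 fun ψ => by
      rw [one_mul]
      have := norm_le_of_positive hT hε (R ψ)
      rwa [hR] at this
    refine ⟨(ε⁻¹ : ℝ) • (1 - R''), fun φ => ?_⟩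
    have : R'' ((φ : H) + ε • T φ) = φ := by
      change ((R ((φ : H) + ε • T φ) : T.domain) : H) = φ
      congr 1
      exact inj _ _ (hR _)
    rw [smul_apply, sub_apply, this,
      one_apply_eq_self, add_sub_cancel_left, smul_smul, inv_mul_cancel₀ hε.ne',
      one_smul]
  unfold regularized
  rw [dif_pos hex]
  exact hex.choose_spec φ

/-- The defining equation determines `T_ε` for positive self-adjoint `T`. -/
theorem regularized_unique {T : H →ₗ.[ℂ] H} (hT : IsPositiveSelfAdjoint T) {ε : ℝ} (hε : 0 < ε)
    {A : H →L[ℂ] H} (hA : ∀ φ : T.domain, A ((φ : H) + ε • T φ) = T φ) :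
    A = regularized T ε := by
  ext ψ
  obtain ⟨φ, rfl⟩ := surjective_one_add hT hε ψ
  rw [hA, regularized_apply hT hε]

/-- The kinetic energy `Tr (T γ) := sup_{ε > 0} Tr (T_ε γ) ∈ [0, ∞]` of a positive trace-class
operator `γ`. -/
def kineticTrace (T : H →ₗ.[ℂ] H) (γ : H →L[ℂ] H) : ℝ≥0∞ :=
  ⨆ ε : {ε : ℝ // 0 < ε}, ENNReal.ofReal (trace (regularized T ε ∘L γ)).re

lemma kineticTrace_add_le (T : H →ₗ.[ℂ] H) {γ γ' : H →L[ℂ] H} (hγ : γ ∈ posTraceClass H)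
    (hγ' : γ' ∈ posTraceClass H) :
    kineticTrace T (γ + γ') ≤ kineticTrace T γ + kineticTrace T γ' := by
  refine iSup_le fun ε => ?_
  rw [trace_comp_add hγ hγ', Complex.add_re]
  exact ENNReal.ofReal_add_le.trans (add_le_add
    (le_iSup (fun ε : {ε : ℝ // 0 < ε} => ENNReal.ofReal (trace (regularized T ε ∘L γ)).re) ε)
    (le_iSup (fun ε : {ε : ℝ // 0 < ε} => ENNReal.ofReal (trace (regularized T ε ∘L γ')).re) ε))

lemma kineticTrace_smul (T : H →ₗ.[ℂ] H) {c : ℝ} (hc : 0 ≤ c) (γ : H →L[ℂ] H) :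
    kineticTrace T (c • γ) = ENNReal.ofReal c * kineticTrace T γ := by
  unfold kineticTrace
  rw [ENNReal.mul_iSup]
  refine iSup_congr fun ε => ?_
  rw [trace_comp_smul, Complex.re_ofReal_mul, ENNReal.ofReal_mul hc]

lemma kineticTrace_zero (T : H →ₗ.[ℂ] H) : kineticTrace T 0 = 0 := by
  have := kineticTrace_smul T le_rfl (0 : H →L[ℂ] H)
  simpa using this

/-! ### The space `X` of density matrices of finite kinetic energy -/

/-- The cone `X⁺` of positive trace-class operators `γ` with `Tr (T γ) < ∞`. -/
def kineticCone (T : H →ₗ.[ℂ] H) : Set (H →L[ℂ] H) :=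
  {γ | γ ∈ posTraceClass H ∧ kineticTrace T γ < ∞}

lemma add_mem_kineticCone {T : H →ₗ.[ℂ] H} {γ γ' : H →L[ℂ] H} (h : γ ∈ kineticCone T)
    (h' : γ' ∈ kineticCone T) : γ + γ' ∈ kineticCone T :=
  ⟨add_mem_posTraceClass h.1 h'.1, lt_of_le_of_lt (kineticTrace_add_le T h.1 h'.1)
    (ENNReal.add_lt_top.2 ⟨h.2, h'.2⟩)⟩

lemma smul_mem_kineticCone {T : H →ₗ.[ℂ] H} {c : ℝ} (hc : 0 ≤ c) {γ : H →L[ℂ] H}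
    (h : γ ∈ kineticCone T) : c • γ ∈ kineticCone T :=
  ⟨smul_mem_posTraceClass hc h.1, by
    rw [kineticTrace_smul T hc]; exact ENNReal.mul_lt_top ENNReal.ofReal_lt_top h.2⟩

lemma zero_mem_kineticCone (T : H →ₗ.[ℂ] H) : (0 : H →L[ℂ] H) ∈ kineticCone T :=
  ⟨zero_mem_posTraceClass, by simp [kineticTrace_zero]⟩

/-- The real vector space `X = X⁺ - X⁺`, as a subspace of the bounded operators. -/
def kineticSubmodule (T : H →ₗ.[ℂ] H) : Submodule ℝ (H →L[ℂ] H) where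
  carrier := {γ | ∃ γp ∈ kineticCone T, ∃ γm ∈ kineticCone T, γ = γp - γm}
  add_mem' := by
    rintro _ _ ⟨a, ha, b, hb, rfl⟩ ⟨c, hc, d, hd, rfl⟩
    exact ⟨a + c, add_mem_kineticCone ha hc, b + d, add_mem_kineticCone hb hd, by abel⟩
  zero_mem' := ⟨0, zero_mem_kineticCone T, 0, zero_mem_kineticCone T, by simp⟩
  smul_mem' := by
    rintro c _ ⟨a, ha, b, hb, rfl⟩
    rcases le_total 0 c with hc | hc
    · exact ⟨c • a, smul_mem_kineticCone hc ha, c • b, smul_mem_kineticCone hc hb, smul_sub _ _ _⟩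
    · refine ⟨(-c) • b, smul_mem_kineticCone (by linarith) hb, (-c) • a,
        smul_mem_kineticCone (by linarith) ha, ?_⟩
      rw [smul_sub, neg_smul, neg_smul]
      abel

/-- The space `X` as a type of its own, so that it does not inherit the operator norm. -/
def KineticSpace (T : H →ₗ.[ℂ] H) : Type _ := ↥(kineticSubmodule T)

instance (T : H →ₗ.[ℂ] H) : AddCommGroup (KineticSpace T) :=
  inferInstanceAs (AddCommGroup ↥(kineticSubmodule T))

instance (T : H →ₗ.[ℂ] H) : Module ℝ (KineticSpace T) :=
  inferInstanceAs (Module ℝ ↥(kineticSubmodule T))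

/-- The operator on `H` that an element of `X` is. -/
def KineticSpace.toOp (T : H →ₗ.[ℂ] H) : KineticSpace T →ₗ[ℝ] (H →L[ℂ] H) :=
  (kineticSubmodule T).subtype

/-- `Tr ((1 + T) γ) = Tr γ + Tr (T γ)` for a positive trace-class operator `γ`. -/
def energyTrace (T : H →ₗ.[ℂ] H) (γ : H →L[ℂ] H) : ℝ≥0∞ := posTrace γ + kineticTrace T γ

/-- `‖γ‖_X`, the infimum of `Tr ((1 + T) γ⁺) + Tr ((1 + T) γ⁻)` over all decompositions
`γ = γ⁺ - γ⁻` into positive trace-class operators, with values in `[0, ∞]`. -/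
def extNormX (T : H →ₗ.[ℂ] H) (γ : H →L[ℂ] H) : ℝ≥0∞ :=
  sInf {r | ∃ γp ∈ posTraceClass H, ∃ γm ∈ posTraceClass H,
    γ = γp - γm ∧ r = energyTrace T γp + energyTrace T γm}

/-- `‖γ‖_X` is finite for `γ ∈ X`. -/
lemma extNormX_lt_top (T : H →ₗ.[ℂ] H) (γ : KineticSpace T) :
    extNormX T (KineticSpace.toOp T γ) < ∞ := by
  obtain ⟨_, a, ha, b, hb, rfl⟩ := γ
  refine lt_of_le_of_lt (sInf_le ⟨a, ha.1, b, hb.1, rfl, rfl⟩) ?_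
  exact ENNReal.add_lt_top.2
    ⟨ENNReal.add_lt_top.2 ⟨(mem_posTraceClass.1 ha.1).2, ha.2⟩,
      ENNReal.add_lt_top.2 ⟨(mem_posTraceClass.1 hb.1).2, hb.2⟩⟩

/-- The norm `‖γ‖_X` on `X`. -/
instance (T : H →ₗ.[ℂ] H) : Norm (KineticSpace T) :=
  ⟨fun γ => (extNormX T (KineticSpace.toOp T γ)).toReal⟩

end Kinetic

section Diagonal

variable {Ω : Type*} [MeasurableSpace Ω]
variable {H : Type*} [NormedAddCommGroup H] [InnerProductSpace ℂ H] [CompleteSpace H]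

/-! ### Projection-valued measures and the diagonal map -/

/-- A projection-valued measure on `Ω`; its values on non-measurable sets are irrelevant.
Countable additivity is meant in the strong operator topology. -/
structure ProjectionValuedMeasure (Ω : Type*) [MeasurableSpace Ω]
    (H : Type*) [NormedAddCommGroup H] [InnerProductSpace ℂ H] [CompleteSpace H] where
  /-- The projection `P(S)`. -/
  proj : Set Ω → (H →L[ℂ] H)
  isStarProjection : ∀ S, MeasurableSet S → IsStarProjection (proj S)
  proj_empty : proj ∅ = 0
  proj_univ : proj Set.univ = 1
  hasSum_iUnion : ∀ S : ℕ → Set Ω, (∀ n, MeasurableSet (S n)) →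
    Pairwise (Function.onFun Disjoint S) → ∀ ψ : H,
      HasSum (fun n => proj (S n) ψ) (proj (⋃ n, S n) ψ)
  proj_inter : ∀ S S', MeasurableSet S → MeasurableSet S' →
    proj (S ∩ S') = proj S ∘L proj S'

/-- `P` is absolutely continuous with respect to `μ`: null sets have zero projection. -/
def ProjectionValuedMeasure.AbsolutelyContinuous (P : ProjectionValuedMeasure Ω H)
    (μ : Measure Ω) : Prop :=
  ∀ S, MeasurableSet S → μ S = 0 → P.proj S = 0

/-- `ρ ∈ L¹(Ω, μ)` is the density with respect to `μ` (Radon–Nikodym derivative) of the signed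
measure `S ↦ Tr (P(S) γ)`. -/
def IsDiagonal (P : ProjectionValuedMeasure Ω H) (μ : Measure Ω) (γ : H →L[ℂ] H)
    (ρ : Lp ℝ 1 μ) : Prop :=
  ∀ S, MeasurableSet S → ((∫ x in S, ρ x ∂μ : ℝ) : ℂ) = trace (P.proj S ∘L γ)

lemma inner_proj (P : ProjectionValuedMeasure Ω H) {S : Set Ω} (hS : MeasurableSet S) (x : H) :
    ⟪x, P.proj S x⟫_ℂ = ((‖P.proj S x‖ ^ 2 : ℝ) : ℂ) := by
  have h := P.isStarProjection S hS
  have h1 : P.proj S (P.proj S x) = P.proj S x := by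
    rw [← mul_apply_eq_comp, h.isIdempotentElem.eq]
  have h2 : (P.proj S).adjoint = P.proj S := h.isSelfAdjoint
  nth_rw 1 [← h1, ← h2]
  rw [ContinuousLinearMap.adjoint_inner_right, inner_self_eq_norm_sq_to_K]
  simp

/-- The finite measure `S ↦ Tr (P(S) γ) = ∑ ‖P(S) s e‖²` for `γ = s²`. -/
def sqrtMeasure (P : ProjectionValuedMeasure Ω H) (s : H →L[ℂ] H) : Measure Ω :=
  Measure.ofMeasurable (fun S _ => ∑' i, ‖P.proj S (s (stdBasis H i))‖ₑ ^ 2)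
    (by simp [P.proj_empty])
    (by
      intro S hS hd
      rw [ENNReal.tsum_comm]
      refine tsum_congr fun i => ?_
      set x := s (stdBasis H i)
      have h1 := (P.hasSum_iUnion S hS hd x).mapL (innerSL ℂ x)
      simp only [innerSL_apply_apply] at h1
      rw [inner_proj P (MeasurableSet.iUnion hS)] at h1
      simp_rw [inner_proj P (hS _)] at h1
      rw [Complex.hasSum_ofReal] at h1
      have h4 := ENNReal.ofReal_tsum_of_nonneg (fun i => by positivity) h1.summable
      rw [h1.tsum_eq] at h4
      simpa only [ENNReal.ofReal_pow (norm_nonneg _), ofReal_norm] using h4)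

lemma sqrtMeasure_apply (P : ProjectionValuedMeasure Ω H) (s : H →L[ℂ] H) {S : Set Ω}
    (hS : MeasurableSet S) :
    sqrtMeasure P s S = ∑' i, ‖P.proj S (s (stdBasis H i))‖ₑ ^ 2 :=
  Measure.ofMeasurable_apply S hS

lemma trace_proj_comp (P : ProjectionValuedMeasure Ω H) {γ s : H →L[ℂ] H}
    (hγ : γ ∈ posTraceClass H) (hs : s.adjoint = s) (h : s ∘L s = γ) {S : Set Ω}
    (hS : MeasurableSet S) :
    trace (P.proj S ∘L γ) = (((sqrtMeasure P s S).toReal : ℝ) : ℂ) := by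
  have hγ' := mem_posTraceClass.1 hγ
  have h1 : ∑' i, ‖s (stdBasis H i)‖ₑ ^ 2 < ∞ := by
    rw [← tsum_enorm_sqrt _ hs h]; exact hγ'.2
  have hP : (P.proj S).adjoint = P.proj S := (P.isStarProjection S hS).isSelfAdjoint
  have h2 : ∑' i, ‖(s ∘L P.proj S) (stdBasis H i)‖ₑ ^ 2 < ∞ := by
    rw [tsum_enorm_adjoint _ (stdBasis H), ContinuousLinearMap.adjoint_comp, hP, hs]
    exact hs_comp_lt_top _ s _ h1
  have e1 : trace (P.proj S ∘L γ) =
      ∑' i, ⟪(s ∘L P.proj S) (stdBasis H i), s (stdBasis H i)⟫_ℂ := by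
    unfold trace
    refine tsum_congr fun i => ?_
    rw [ContinuousLinearMap.comp_apply, ← h, ContinuousLinearMap.comp_apply,
      ContinuousLinearMap.comp_apply, ← ContinuousLinearMap.adjoint_inner_left, hP]
    nth_rw 1 [← hs]
    rw [ContinuousLinearMap.adjoint_inner_right]
  rw [e1, tsum_inner_adjoint _ h1 h2, sqrtMeasure_apply P s hS,
    ENNReal.tsum_toReal_eq (fun i => by simp), Complex.ofReal_tsum]
  refine tsum_congr fun j => ?_
  rw [ContinuousLinearMap.adjoint_comp, hP, hs, ContinuousLinearMap.comp_apply, inner_proj P hS]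
  simp

variable {μ : Measure Ω}

lemma isDiagonal_exists_pos [SigmaFinite μ] (P : ProjectionValuedMeasure Ω H)
    (hP : P.AbsolutelyContinuous μ) {γ : H →L[ℂ] H} (hγ : γ ∈ posTraceClass H) :
    ∃ ρ : Lp ℝ 1 μ, IsDiagonal P μ γ ρ := by
  obtain ⟨s, hs, h⟩ := exists_sqrt (mem_posTraceClass.1 hγ).1
  have hfin : IsFiniteMeasure (sqrtMeasure P s) := by
    refine ⟨?_⟩
    rw [sqrtMeasure_apply P s MeasurableSet.univ, P.proj_univ]
    simp only [one_apply_eq_self]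
    rw [← tsum_enorm_sqrt _ hs h]
    exact (mem_posTraceClass.1 hγ).2
  have hac : sqrtMeasure P s ≪ μ := by
    refine Measure.AbsolutelyContinuous.mk fun S hS h0 => ?_
    rw [sqrtMeasure_apply P s hS, hP S hS h0]
    simp
  have hint : Integrable (fun x => ((sqrtMeasure P s).rnDeriv μ x).toReal) μ :=
    Measure.integrable_toReal_rnDeriv
  refine ⟨hint.toL1 _, fun S hS => ?_⟩
  rw [trace_proj_comp P hγ hs h hS, setIntegral_congr_ae hS
    (hint.coeFn_toL1.mono fun x hx _ => hx), Measure.setIntegral_toReal_rnDeriv hac S]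
  rfl

lemma IsDiagonal.sub {P : ProjectionValuedMeasure Ω H} {γ γ' : H →L[ℂ] H}
    (hγ : γ ∈ posTraceClass H) (hγ' : γ' ∈ posTraceClass H) {ρ ρ' : Lp ℝ 1 μ}
    (h : IsDiagonal P μ γ ρ) (h' : IsDiagonal P μ γ' ρ') :
    IsDiagonal P μ (γ - γ') (ρ - ρ') := by
  intro S hS
  rw [trace_comp_sub hγ hγ', ← h S hS, ← h' S hS, ← Complex.ofReal_sub, ← integral_sub
    (L1.integrable_coeFn ρ).integrableOn (L1.integrable_coeFn ρ').integrableOn]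
  congr 1
  exact setIntegral_congr_ae hS ((Lp.coeFn_sub ρ ρ').mono fun x hx _ => hx)

lemma IsDiagonal.unique {P : ProjectionValuedMeasure Ω H} {γ : H →L[ℂ] H} {ρ ρ' : Lp ℝ 1 μ}
    (h : IsDiagonal P μ γ ρ) (h' : IsDiagonal P μ γ ρ') : ρ = ρ' := by
  refine Lp.ext ((L1.integrable_coeFn ρ).ae_eq_of_forall_setIntegral_eq _ _
    (L1.integrable_coeFn ρ') fun S hS _ => ?_)
  exact_mod_cast (h S hS).trans (h' S hS).symm

/-- Every `γ ∈ X` has a density. -/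
theorem isDiagonal_exists [SigmaFinite μ] (T : H →ₗ.[ℂ] H) (P : ProjectionValuedMeasure Ω H)
    (hP : P.AbsolutelyContinuous μ) (γ : KineticSpace T) :
    ∃ ρ : Lp ℝ 1 μ, IsDiagonal P μ (KineticSpace.toOp T γ) ρ := by
  obtain ⟨_, a, ha, b, hb, rfl⟩ := γ
  obtain ⟨ρ, hρ⟩ := isDiagonal_exists_pos P hP ha.1
  obtain ⟨ρ', hρ'⟩ := isDiagonal_exists_pos P hP hb.1
  exact ⟨ρ - ρ', hρ.sub ha.1 hb.1 hρ'⟩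

lemma trace_toOp_add (T : H →ₗ.[ℂ] H) (A : H →L[ℂ] H) (γ γ' : KineticSpace T) :
    trace (A ∘L KineticSpace.toOp T (γ + γ')) =
      trace (A ∘L KineticSpace.toOp T γ) + trace (A ∘L KineticSpace.toOp T γ') := by
  rw [map_add]
  obtain ⟨_, a, ha, b, hb, rfl⟩ := γ
  obtain ⟨_, c, hc, d, hd, rfl⟩ := γ'
  change trace (A ∘L (a - b + (c - d))) = trace (A ∘L (a - b)) + trace (A ∘L (c - d))
  rw [sub_add_sub_comm, trace_comp_sub (add_mem_posTraceClass ha.1 hc.1)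
    (add_mem_posTraceClass hb.1 hd.1), trace_comp_add ha.1 hc.1, trace_comp_add hb.1 hd.1,
    trace_comp_sub ha.1 hb.1, trace_comp_sub hc.1 hd.1]
  ring

/-- The diagonal map `D : X → L¹(Ω, μ)`: `D γ` is the density with respect to `μ` of the signed
measure `S ↦ Tr (P(S) γ)`. -/
def diagonal [SigmaFinite μ] (T : H →ₗ.[ℂ] H) (P : ProjectionValuedMeasure Ω H)
    (hP : P.AbsolutelyContinuous μ) : KineticSpace T →ₗ[ℝ] Lp ℝ 1 μ where
  toFun γ := (isDiagonal_exists T P hP γ).choose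
  map_add' γ γ' := by
    refine (isDiagonal_exists T P hP (γ + γ')).choose_spec.unique ?_
    intro S hS
    rw [trace_toOp_add, ← (isDiagonal_exists T P hP γ).choose_spec S hS,
      ← (isDiagonal_exists T P hP γ').choose_spec S hS, ← Complex.ofReal_add, ← integral_add
      (L1.integrable_coeFn _).integrableOn (L1.integrable_coeFn _).integrableOn]
    congr 1
    exact setIntegral_congr_ae hS ((Lp.coeFn_add _ _).mono fun x hx _ => hx)
  map_smul' c γ := by
    refine (isDiagonal_exists T P hP (c • γ)).choose_spec.unique ?_
    intro S hS
    rw [map_smul, trace_comp_smul, ← (isDiagonal_exists T P hP γ).choose_spec S hS,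
      ← Complex.ofReal_mul, ← integral_const_mul]
    congr 1
    exact setIntegral_congr_ae hS ((Lp.coeFn_smul c _).mono fun x hx _ => hx)

/-- The characterization of the diagonal map: `∫_S D γ = Tr (P(S) γ)`. -/
theorem diagonal_spec [SigmaFinite μ] (T : H →ₗ.[ℂ] H) (P : ProjectionValuedMeasure Ω H)
    (hP : P.AbsolutelyContinuous μ) (γ : KineticSpace T) :
    IsDiagonal P μ (KineticSpace.toOp T γ) (diagonal T P hP γ) :=
  (isDiagonal_exists T P hP γ).choose_spec

/-! ### The space `Ξ` of densities of finite kinetic energy -/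

/-- The space `Ξ = D(X)`, as a type of its own, so that it does not inherit the `L¹` norm. -/
def DensitySpace [SigmaFinite μ] (T : H →ₗ.[ℂ] H) (P : ProjectionValuedMeasure Ω H)
    (hP : P.AbsolutelyContinuous μ) : Type _ :=
  ↥(LinearMap.range (diagonal T P hP))

section

variable [SigmaFinite μ] (T : H →ₗ.[ℂ] H) (P : ProjectionValuedMeasure Ω H)
  (hP : P.AbsolutelyContinuous μ)

instance : AddCommGroup (DensitySpace T P hP) :=
  inferInstanceAs (AddCommGroup ↥(LinearMap.range (diagonal T P hP)))

instance : Module ℝ (DensitySpace T P hP) :=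
  inferInstanceAs (Module ℝ ↥(LinearMap.range (diagonal T P hP)))

/-- The integrable function that an element of `Ξ` is. -/
def DensitySpace.toL1 : DensitySpace T P hP →ₗ[ℝ] Lp ℝ 1 μ :=
  (LinearMap.range (diagonal T P hP)).subtype

/-- The norm `‖ρ‖_Ξ = inf {‖γ‖_X : γ ∈ X, D γ = ρ}` on `Ξ`. -/
instance : Norm (DensitySpace T P hP) :=
  ⟨fun ρ => sInf {r : ℝ | ∃ γ : KineticSpace T,
    diagonal T P hP γ = DensitySpace.toL1 T P hP ρ ∧ r = ‖γ‖}⟩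

end

end Diagonal

end

end DensityFunctional

/-!
The norm of `X` dominates every functional `γ ↦ Tr (A γ)` with `A` bounded, up to the factor `‖A‖`
(`enorm_trace_comp_le_extNormX`), and it dominates the operator norm (`enorm_le_extNormX`). The
second bound makes it definite. The first one, for `A = P(S)`, bounds `∫_S D γ`, so that `ker D` is
closed and the norm of `Ξ` is definite (`densitySpace_eq_zero_of_norm_eq_zero`).

`X` is complete. For a series of positive operators with summable traces, which then converges in
operator norm, `Tr ((1 + T) ·)` is countably subadditive (`energyTrace_tsum_le`): the trace is
countably additive, and `Tr (T ·)` is a supremum of the functionals `Tr (T_ε ·)`, each of which is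
continuous for the trace norm because `T_ε` is bounded. Given an absolutely convergent series in
`X`, decompose each term into positive parts of nearly optimal energy and sum these separately; the
same subadditivity, applied to the tails, gives convergence in the norm of `X`
(`exists_tendsto_sum`).

The norm of `Ξ` is the quotient norm of `X / ker D` carried over by the algebraic isomorphism
`X / ker D ≃ D(X)` (`norm_quotKerEquivDensitySpace`). Hence it is a norm, the isomorphism is
isometric, and `Ξ` is complete because a quotient of a complete space is.
-/

namespace DensityFunctional

open Filter Topology

noncomputable section

variable {H : Type*} [NormedAddCommGroup H] [InnerProductSpace ℂ H] [CompleteSpace H]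

/-! ### Trace estimates for positive operators -/

/-- With `s = √γ`, cyclicity turns `Tr (A γ)` into `∑ ⟨s e, A s e⟩`, which Cauchy–Schwarz
bounds termwise. -/
lemma enorm_trace_comp_le {γ : H →L[ℂ] H} (hγ : γ ∈ posTraceClass H) (A : H →L[ℂ] H) :
    ‖trace (A ∘L γ)‖ₑ ≤ ‖A‖ₑ * posTrace γ := by
  have hγ' := mem_posTraceClass.1 hγ
  obtain ⟨s, hs, h⟩ := exists_sqrt hγ'.1
  have h1 : ∑' i, ‖s (stdBasis H i)‖ₑ ^ 2 < ∞ := by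
    rw [← tsum_enorm_sqrt _ hs h]; exact hγ'.2
  have h2 : ∑' i, ‖(s ∘L A.adjoint) (stdBasis H i)‖ₑ ^ 2 < ∞ := by
    rw [tsum_enorm_adjoint _ (stdBasis H), ContinuousLinearMap.adjoint_comp,
      ContinuousLinearMap.adjoint_adjoint, hs]
    exact hs_comp_lt_top A s _ h1
  have e1 : trace (A ∘L γ) =
      ∑' i, ⟪(s ∘L A.adjoint) (stdBasis H i), s (stdBasis H i)⟫_ℂ := by
    unfold trace
    refine tsum_congr fun i => ?_
    rw [ContinuousLinearMap.comp_apply, ← h, ContinuousLinearMap.comp_apply,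
      ContinuousLinearMap.comp_apply, ← ContinuousLinearMap.adjoint_inner_left A]
    nth_rw 1 [← hs]
    rw [ContinuousLinearMap.adjoint_inner_right]
  rw [e1, tsum_inner_adjoint _ h1 h2, posTrace, tsum_enorm_sqrt _ hs h,
    ContinuousLinearMap.adjoint_comp, ContinuousLinearMap.adjoint_adjoint, hs,
    ← ENNReal.tsum_mul_left]
  refine enorm_tsum_le_tsum_enorm.trans (ENNReal.tsum_le_tsum fun i => ?_)
  calc ‖⟪s (stdBasis H i), (A ∘L s) (stdBasis H i)⟫_ℂ‖ₑ
      ≤ ‖s (stdBasis H i)‖ₑ * ‖A (s (stdBasis H i))‖ₑ := by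
        rw [← ofReal_norm, ← ofReal_norm, ← ofReal_norm, ← ENNReal.ofReal_mul (norm_nonneg _)]
        exact ENNReal.ofReal_le_ofReal (norm_inner_le_norm _ _)
    _ ≤ ‖s (stdBasis H i)‖ₑ * (‖A‖ₑ * ‖s (stdBasis H i)‖ₑ) := by
        gcongr
        exact A.le_opENorm _
    _ = ‖A‖ₑ * ‖s (stdBasis H i)‖ₑ ^ 2 := by ring

/-- The operator norm is dominated by the trace norm: the Hilbert–Schmidt norm of `√γ`
dominates `‖√γ‖`. -/
lemma enorm_le_posTrace {γ : H →L[ℂ] H} (hγ : 0 ≤ γ) : ‖γ‖ₑ ≤ posTrace γ := by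
  obtain ⟨s, hs, h⟩ := exists_sqrt hγ
  have h1 : ∀ x : H, ‖s x‖ₑ ^ 2 ≤ posTrace γ * ‖x‖ₑ ^ 2 := by
    intro x
    rw [← tsum_enorm_inner (stdBasis H), posTrace, tsum_enorm_sqrt _ hs h,
      ← ENNReal.tsum_mul_right]
    refine ENNReal.tsum_le_tsum fun i => ?_
    rw [← mul_pow]
    gcongr
    nth_rw 1 [← hs]
    rw [ContinuousLinearMap.adjoint_inner_right, ← ofReal_norm, ← ofReal_norm, ← ofReal_norm,
      ← ENNReal.ofReal_mul (norm_nonneg _)]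
    exact ENNReal.ofReal_le_ofReal (norm_inner_le_norm _ _)
  by_cases hfin : posTrace γ = ∞
  · simp [hfin]
  have h2 : ∀ x : H, ‖s x‖ ^ 2 ≤ (posTrace γ).toReal * ‖x‖ ^ 2 := by
    intro x
    have := ENNReal.toReal_mono (by finiteness) (h1 x)
    simpa using this
  have h3 : ‖s‖ ≤ √(posTrace γ).toReal := by
    refine s.opNorm_le_bound (Real.sqrt_nonneg _) fun x => ?_
    refine abs_le_of_sq_le_sq' ?_ (by positivity) |>.2
    rw [mul_pow, Real.sq_sqrt ENNReal.toReal_nonneg]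
    exact h2 x
  rw [← ofReal_norm]
  refine ENNReal.ofReal_le_of_le_toReal ?_
  calc ‖γ‖ ≤ ‖s‖ * ‖s‖ := by rw [← h]; exact s.opNorm_comp_le s
    _ ≤ √(posTrace γ).toReal * √(posTrace γ).toReal := by gcongr
    _ = (posTrace γ).toReal := Real.mul_self_sqrt ENNReal.toReal_nonneg

/-! ### Countable sums of positive trace-class operators -/

variable {a : ℕ → H →L[ℂ] H}

lemma summable_of_tsum_posTrace (ha : ∀ n, 0 ≤ a n) (h : ∑' n, posTrace (a n) ≠ ∞) :
    Summable a := by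
  refine Summable.of_norm ?_
  have h' : ∑' n, ‖a n‖ₑ ≠ ∞ :=
    ne_top_of_le_ne_top h (ENNReal.tsum_le_tsum fun n => enorm_le_posTrace (ha n))
  simpa using ENNReal.summable_toReal h'

lemma tsum_nonneg_of_tsum_posTrace (ha : ∀ n, 0 ≤ a n) (h : ∑' n, posTrace (a n) ≠ ∞) :
    0 ≤ ∑' n, a n := by
  have hs := summable_of_tsum_posTrace ha h
  have hpos : IsClosed {A : H →L[ℂ] H | 0 ≤ A} := isClosed_Ici
  refine hpos.mem_of_tendsto hs.hasSum.tendsto_sum_nat (Eventually.of_forall fun N => ?_)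
  exact Finset.sum_nonneg fun n _ => ha n

lemma posTrace_tsum (ha : ∀ n, 0 ≤ a n) (h : ∑' n, posTrace (a n) ≠ ∞) :
    posTrace (∑' n, a n) = ∑' n, posTrace (a n) := by
  have hs := summable_of_tsum_posTrace ha h
  unfold posTrace
  rw [ENNReal.tsum_comm]
  refine tsum_congr fun i => ?_
  have h1 : HasSum (fun n => (⟪stdBasis H i, a n (stdBasis H i)⟫_ℂ).re)
      (⟪stdBasis H i, (∑' n, a n) (stdBasis H i)⟫_ℂ).re := by
    have h2 := (hs.hasSum.mapL (ContinuousLinearMap.apply ℂ H (stdBasis H i))).mapL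
      (innerSL ℂ (stdBasis H i))
    simpa using Complex.hasSum_re h2
  rw [← h1.tsum_eq, ENNReal.ofReal_tsum_of_nonneg (fun n => re_inner_nonneg (ha n) _) h1.summable]

lemma tsum_mem_posTraceClass (ha : ∀ n, 0 ≤ a n) (h : ∑' n, posTrace (a n) ≠ ∞) :
    ∑' n, a n ∈ posTraceClass H :=
  mem_posTraceClass.2 ⟨tsum_nonneg_of_tsum_posTrace ha h, by
    rw [posTrace_tsum ha h]; exact h.lt_top⟩

/-- Subadditivity of the kinetic energy on partial sums, with the membership in the positive
trace class that the induction needs. -/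
lemma kineticTrace_sum_le (T : H →ₗ.[ℂ] H) (ha : ∀ n, a n ∈ posTraceClass H) (N : ℕ) :
    (∑ n ∈ Finset.range N, a n) ∈ posTraceClass H ∧
      kineticTrace T (∑ n ∈ Finset.range N, a n) ≤
        ∑ n ∈ Finset.range N, kineticTrace T (a n) := by
  induction N with
  | zero => simp [zero_mem_posTraceClass, kineticTrace_zero]
  | succ N ih =>
    rw [Finset.sum_range_succ, Finset.sum_range_succ]
    exact ⟨add_mem_posTraceClass ih.1 (ha N),
      (kineticTrace_add_le T ih.1 (ha N)).trans (by gcongr; exact ih.2)⟩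

/-- The kinetic energy is countably subadditive. Only the boundedness of `T_ε` enters: the
contribution of the tail of the series to `Tr (T_ε ·)` is at most `‖T_ε‖` times the trace of the
tail, which tends to `0`. -/
lemma kineticTrace_tsum_le (T : H →ₗ.[ℂ] H) (ha : ∀ n, a n ∈ posTraceClass H)
    (h : ∑' n, posTrace (a n) ≠ ∞) :
    kineticTrace T (∑' n, a n) ≤ ∑' n, kineticTrace T (a n) := by
  have ha' : ∀ n, 0 ≤ a n := fun n => (ha n).1
  refine iSup_le fun ε => ?_
  set A := regularized T ε
  have hsum := summable_of_tsum_posTrace ha' h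
  have htail : ∀ N, ∑' n, posTrace (a (n + N)) ≠ ∞ := fun N =>
    ne_top_of_le_ne_top h (ENNReal.tsum_comp_le_tsum_of_injective (add_left_injective N) _)
  have hN : ∀ N, ENNReal.ofReal (trace (A ∘L ∑' n, a n)).re ≤
      ∑' n, kineticTrace T (a n) + ‖A‖ₑ * ∑' n, posTrace (a (n + N)) := by
    intro N
    have hfin := kineticTrace_sum_le T ha N
    have htl := tsum_mem_posTraceClass (fun n => ha' (n + N)) (htail N)
    rw [← hsum.sum_add_tsum_nat_add N, trace_comp_add hfin.1 htl, Complex.add_re]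
    refine ENNReal.ofReal_add_le.trans (add_le_add ?_ ?_)
    · exact (le_iSup (fun ε : {ε : ℝ // 0 < ε} => ENNReal.ofReal (trace (regularized T ε ∘L
        ∑ n ∈ Finset.range N, a n)).re) ε).trans (hfin.2.trans (ENNReal.sum_le_tsum _))
    · rw [← posTrace_tsum (fun n => ha' (n + N)) (htail N)]
      refine le_trans ?_ (enorm_trace_comp_le htl A)
      rw [← ofReal_norm]
      exact ENNReal.ofReal_le_ofReal (Complex.re_le_norm _)
  have hlim := ENNReal.Tendsto.const_mul (a := ‖A‖ₑ)
    (ENNReal.tendsto_sum_nat_add (fun n => posTrace (a n)) h) (Or.inr (by simp))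
  have hlim' := hlim.const_add (∑' n, kineticTrace T (a n))
  rw [mul_zero, add_zero] at hlim'
  exact ge_of_tendsto' hlim' hN

lemma energyTrace_tsum_le (T : H →ₗ.[ℂ] H) (ha : ∀ n, a n ∈ posTraceClass H)
    (h : ∑' n, posTrace (a n) ≠ ∞) :
    energyTrace T (∑' n, a n) ≤ ∑' n, energyTrace T (a n) := by
  unfold energyTrace
  rw [ENNReal.tsum_add, posTrace_tsum (fun n => (ha n).1) h]
  gcongr
  exact kineticTrace_tsum_le T ha h

lemma energyTrace_add_le (T : H →ₗ.[ℂ] H) {γ γ' : H →L[ℂ] H} (hγ : γ ∈ posTraceClass H)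
    (hγ' : γ' ∈ posTraceClass H) :
    energyTrace T (γ + γ') ≤ energyTrace T γ + energyTrace T γ' := by
  unfold energyTrace
  rw [posTrace_add hγ.1 hγ'.1, add_add_add_comm]
  gcongr
  exact kineticTrace_add_le T hγ hγ'

lemma energyTrace_smul (T : H →ₗ.[ℂ] H) {c : ℝ} (hc : 0 ≤ c) (γ : H →L[ℂ] H) :
    energyTrace T (c • γ) = ENNReal.ofReal c * energyTrace T γ := by
  unfold energyTrace
  rw [posTrace_smul hc, kineticTrace_smul T hc, mul_add]

lemma mem_kineticCone_of_energyTrace_lt_top {T : H →ₗ.[ℂ] H} {γ : H →L[ℂ] H}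
    (hγ : γ ∈ posTraceClass H) (h : energyTrace T γ < ∞) : γ ∈ kineticCone T :=
  ⟨hγ, lt_of_le_of_lt le_add_self h⟩

/-! ### The norm of `X` -/

lemma extNormX_le (T : H →ₗ.[ℂ] H) {a b : H →L[ℂ] H} (ha : a ∈ posTraceClass H)
    (hb : b ∈ posTraceClass H) : extNormX T (a - b) ≤ energyTrace T a + energyTrace T b :=
  sInf_le ⟨a, ha, b, hb, rfl, rfl⟩

lemma exists_of_extNormX_lt {T : H →ₗ.[ℂ] H} {γ : H →L[ℂ] H} {r : ℝ≥0∞}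
    (h : extNormX T γ < r) : ∃ a ∈ posTraceClass H, ∃ b ∈ posTraceClass H,
      γ = a - b ∧ energyTrace T a + energyTrace T b < r := by
  obtain ⟨_, ⟨a, ha, b, hb, h1, rfl⟩, h2⟩ := sInf_lt_iff.1 h
  exact ⟨a, ha, b, hb, h1, h2⟩

lemma extNormX_add_le (T : H →ₗ.[ℂ] H) (γ γ' : H →L[ℂ] H) :
    extNormX T (γ + γ') ≤ extNormX T γ + extNormX T γ' := by
  refine ENNReal.le_of_forall_pos_le_add fun ε hε hfin => ?_
  obtain ⟨h1, h2⟩ := ENNReal.add_lt_top.1 hfin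
  have hε' : (ε / 2 : ℝ≥0∞) ≠ 0 := by simpa using hε.ne'
  obtain ⟨a, ha, b, hb, rfl, hab⟩ := exists_of_extNormX_lt (ENNReal.lt_add_right h1.ne hε')
  obtain ⟨c, hc, d, hd, rfl, hcd⟩ := exists_of_extNormX_lt (ENNReal.lt_add_right h2.ne hε')
  calc extNormX T (a - b + (c - d))
      ≤ energyTrace T (a + c) + energyTrace T (b + d) := by
        rw [sub_add_sub_comm]
        exact extNormX_le T (add_mem_posTraceClass ha hc) (add_mem_posTraceClass hb hd)
    _ ≤ (energyTrace T a + energyTrace T c) + (energyTrace T b + energyTrace T d) :=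
        add_le_add (energyTrace_add_le T ha hc) (energyTrace_add_le T hb hd)
    _ = (energyTrace T a + energyTrace T b) + (energyTrace T c + energyTrace T d) := by ring
    _ ≤ (extNormX T (a - b) + ε / 2) + (extNormX T (c - d) + ε / 2) :=
        add_le_add hab.le hcd.le
    _ = extNormX T (a - b) + extNormX T (c - d) + ε := by
        rw [add_add_add_comm, ENNReal.add_halves]

lemma extNormX_neg_le (T : H →ₗ.[ℂ] H) (γ : H →L[ℂ] H) : extNormX T (-γ) ≤ extNormX T γ := by
  refine le_sInf ?_
  rintro _ ⟨a, ha, b, hb, rfl, rfl⟩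
  rw [neg_sub, add_comm]
  exact extNormX_le T hb ha

lemma extNormX_smul_le (T : H →ₗ.[ℂ] H) {c : ℝ} (hc : 0 < c) (γ : H →L[ℂ] H) :
    extNormX T (c • γ) ≤ ENNReal.ofReal c * extNormX T γ := by
  conv_rhs => rw [extNormX, sInf_eq_iInf',
    ENNReal.mul_iInf_of_ne (by simpa using hc) ENNReal.ofReal_ne_top]
  refine le_iInf ?_
  rintro ⟨_, a, ha, b, hb, rfl, rfl⟩
  rw [mul_add, ← energyTrace_smul T hc.le, ← energyTrace_smul T hc.le, smul_sub]
  exact extNormX_le T (smul_mem_posTraceClass hc.le ha) (smul_mem_posTraceClass hc.le hb)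

lemma enorm_le_extNormX (T : H →ₗ.[ℂ] H) (γ : H →L[ℂ] H) : ‖γ‖ₑ ≤ extNormX T γ := by
  refine le_sInf ?_
  rintro _ ⟨a, ha, b, hb, rfl, rfl⟩
  exact (enorm_sub_le).trans (add_le_add ((enorm_le_posTrace ha.1).trans le_self_add)
    ((enorm_le_posTrace hb.1).trans le_self_add))

/-- Every functional `γ ↦ Tr (A γ)` is continuous for the norm of `X`. -/
lemma enorm_trace_comp_le_extNormX (T : H →ₗ.[ℂ] H) (A γ : H →L[ℂ] H) :
    ‖trace (A ∘L γ)‖ₑ ≤ ‖A‖ₑ * extNormX T γ := by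
  -- `A = 0` is separate because `extNormX T γ` may be infinite.
  rcases eq_or_ne A 0 with rfl | hA
  · simp [trace]
  conv_rhs => rw [extNormX, sInf_eq_iInf',
    ENNReal.mul_iInf_of_ne (by simpa using hA) enorm_ne_top]
  refine le_iInf ?_
  rintro ⟨_, a, ha, b, hb, rfl, rfl⟩
  rw [trace_comp_sub ha hb, mul_add]
  refine enorm_sub_le.trans (add_le_add ((enorm_trace_comp_le ha A).trans ?_)
    ((enorm_trace_comp_le hb A).trans ?_)) <;> gcongr <;> exact le_self_add

lemma kineticSpace_norm_nonneg (T : H →ₗ.[ℂ] H) (γ : KineticSpace T) : 0 ≤ ‖γ‖ :=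
  ENNReal.toReal_nonneg

lemma kineticSpace_norm_eq (T : H →ₗ.[ℂ] H) (γ : KineticSpace T) :
    ‖γ‖ = (extNormX T (KineticSpace.toOp T γ)).toReal := rfl

lemma ofReal_norm_kineticSpace (T : H →ₗ.[ℂ] H) (γ : KineticSpace T) :
    ENNReal.ofReal ‖γ‖ = extNormX T (KineticSpace.toOp T γ) :=
  ENNReal.ofReal_toReal (extNormX_lt_top T γ).ne

lemma norm_trace_comp_le (T : H →ₗ.[ℂ] H) (A : H →L[ℂ] H) (γ : KineticSpace T) :
    ‖trace (A ∘L KineticSpace.toOp T γ)‖ ≤ ‖A‖ * ‖γ‖ := by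
  rw [← ENNReal.ofReal_le_ofReal_iff (mul_nonneg (norm_nonneg _) (kineticSpace_norm_nonneg T _)),
    ENNReal.ofReal_mul (norm_nonneg _), ofReal_norm_kineticSpace, ofReal_norm, ofReal_norm]
  exact enorm_trace_comp_le_extNormX T A _

lemma norm_smul_le_kineticSpace (T : H →ₗ.[ℂ] H) {c : ℝ} (hc : c ≠ 0) (γ : KineticSpace T) :
    ‖c • γ‖ ≤ |c| * ‖γ‖ := by
  rw [← ENNReal.ofReal_le_ofReal_iff (mul_nonneg (abs_nonneg _) (kineticSpace_norm_nonneg T _)),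
    ENNReal.ofReal_mul (abs_nonneg _), ofReal_norm_kineticSpace, ofReal_norm_kineticSpace, map_smul]
  rcases hc.lt_or_gt with h | h
  · rw [abs_of_neg h, ← neg_neg c, neg_smul, neg_neg]
    exact (extNormX_neg_le T _).trans (extNormX_smul_le T (by linarith) _)
  · rw [abs_of_pos h]
    exact extNormX_smul_le T h _

/-- `‖·‖_X` is a norm; it is definite because it dominates the operator norm. -/
theorem kineticSpace_normedSpaceCore (T : H →ₗ.[ℂ] H) :
    NormedSpace.Core ℝ (KineticSpace T) := by
  have hzero : ∀ γ : KineticSpace T, ‖γ‖ = 0 ↔ γ = 0 := by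
    intro γ
    constructor
    · intro h
      have h1 := enorm_le_extNormX T (KineticSpace.toOp T γ)
      rw [← ofReal_norm_kineticSpace, h, ENNReal.ofReal_zero, nonpos_iff_eq_zero,
        enorm_eq_zero] at h1
      exact Subtype.ext h1
    · rintro rfl
      have h := extNormX_le T (zero_mem_posTraceClass (H := H)) zero_mem_posTraceClass
      rw [energyTrace, posTrace_zero, kineticTrace_zero] at h
      rw [kineticSpace_norm_eq, map_zero, ENNReal.toReal_eq_zero_iff]
      exact Or.inl (by simpa using h)
  refine ⟨⟨kineticSpace_norm_nonneg T, fun c γ => ?_, fun γ γ' => ?_⟩, hzero⟩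
  · rcases eq_or_ne c 0 with rfl | hc
    · rw [zero_smul, norm_zero, zero_mul, hzero]
    refine le_antisymm (norm_smul_le_kineticSpace T hc γ) ?_
    have h := norm_smul_le_kineticSpace T (inv_ne_zero hc) (c • γ)
    rw [inv_smul_smul₀ hc, abs_inv] at h
    rwa [Real.norm_eq_abs, mul_comm, ← le_div_iff₀ (abs_pos.2 hc), div_eq_inv_mul]
  · have h := extNormX_add_le T (KineticSpace.toOp T γ) (KineticSpace.toOp T γ')
    rw [← map_add, ← ofReal_norm_kineticSpace, ← ofReal_norm_kineticSpace,
      ← ofReal_norm_kineticSpace,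
      ← ENNReal.ofReal_add (kineticSpace_norm_nonneg T _) (kineticSpace_norm_nonneg T _),
      ENNReal.ofReal_le_ofReal_iff
        (add_nonneg (kineticSpace_norm_nonneg T _) (kineticSpace_norm_nonneg T _))] at h
    exact h

/-! ### Completeness of `X` -/

/-- An absolutely convergent series in `X` converges: split each term into positive parts whose
energies are within a summable error of its norm, and sum the parts separately. -/
lemma exists_tendsto_sum (T : H →ₗ.[ℂ] H) (u : ℕ → KineticSpace T)
    (hu : Summable fun n => ‖u n‖) :
    ∃ γ : KineticSpace T,
      Tendsto (fun N => ‖∑ n ∈ Finset.range N, u n - γ‖) atTop (𝓝 0) := by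
  have hlt : ∀ n, extNormX T (KineticSpace.toOp T (u n)) <
      ENNReal.ofReal (‖u n‖ + (1 / 2) ^ n) := by
    intro n
    rw [← ofReal_norm_kineticSpace,
      ENNReal.ofReal_lt_ofReal_iff_of_nonneg (kineticSpace_norm_nonneg T _)]
    exact lt_add_of_pos_right _ (by positivity)
  choose a ha b hb hab hE using fun n => exists_of_extNormX_lt (hlt n)
  have hfin : ∑' n, (energyTrace T (a n) + energyTrace T (b n)) ≠ ∞ := by
    refine ne_top_of_le_ne_top ?_ (ENNReal.tsum_le_tsum fun n => (hE n).le)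
    rw [← ENNReal.ofReal_tsum_of_nonneg
      (fun n => add_nonneg (kineticSpace_norm_nonneg T _) (by positivity))
      (hu.add (summable_geometric_two))]
    exact ENNReal.ofReal_ne_top
  rw [ENNReal.tsum_add] at hfin
  obtain ⟨hfa, hfb⟩ := ENNReal.add_ne_top.1 hfin
  have htr : ∀ c : ℕ → H →L[ℂ] H, ∑' n, energyTrace T (c n) ≠ ∞ → ∑' n, posTrace (c n) ≠ ∞ :=
    fun c h => ne_top_of_le_ne_top h (ENNReal.tsum_le_tsum fun n => le_self_add)
  have hcone : ∀ c : ℕ → H →L[ℂ] H, (∀ n, c n ∈ posTraceClass H) →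
      ∑' n, energyTrace T (c n) ≠ ∞ → ∑' n, c n ∈ kineticCone T := fun c hc h =>
    mem_kineticCone_of_energyTrace_lt_top (tsum_mem_posTraceClass (fun n => (hc n).1) (htr c h))
      ((energyTrace_tsum_le T hc (htr c h)).trans_lt h.lt_top)
  have htail : ∀ (c : ℕ → H →L[ℂ] H) N, ∑' n, energyTrace T (c n) ≠ ∞ →
      ∑' n, energyTrace T (c (n + N)) ≠ ∞ := fun c N h =>
    ne_top_of_le_ne_top h (ENNReal.tsum_comp_le_tsum_of_injective (add_left_injective N) _)
  let γ : KineticSpace T :=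
    ⟨∑' n, a n - ∑' n, b n, _, hcone a ha hfa, _, hcone b hb hfb, rfl⟩
  refine ⟨γ, ?_⟩
  have hbound : ∀ N, extNormX T (KineticSpace.toOp T (∑ n ∈ Finset.range N, u n - γ)) ≤
      ∑' n, energyTrace T (b (n + N)) + ∑' n, energyTrace T (a (n + N)) := by
    intro N
    have hsa := summable_of_tsum_posTrace (fun n => (ha n).1) (htr a hfa)
    have hsb := summable_of_tsum_posTrace (fun n => (hb n).1) (htr b hfb)
    have e : KineticSpace.toOp T (∑ n ∈ Finset.range N, u n - γ) =
        ∑' n, b (n + N) - ∑' n, a (n + N) := by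
      have e1 : KineticSpace.toOp T γ = ∑' n, a n - ∑' n, b n := rfl
      rw [map_sub, map_sum, e1, Finset.sum_congr rfl fun n _ => hab n, Finset.sum_sub_distrib,
        ← hsa.sum_add_tsum_nat_add N, ← hsb.sum_add_tsum_nat_add N]
      abel
    rw [e]
    have hta := htr _ (htail a N hfa)
    have htb := htr _ (htail b N hfb)
    exact (extNormX_le T (tsum_mem_posTraceClass (fun n => (hb _).1) htb)
      (tsum_mem_posTraceClass (fun n => (ha _).1) hta)).trans
      (add_le_add (energyTrace_tsum_le T (fun n => hb _) htb)
        (energyTrace_tsum_le T (fun n => ha _) hta))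
  have hlim : Tendsto (fun N => extNormX T (KineticSpace.toOp T
      (∑ n ∈ Finset.range N, u n - γ))) atTop (𝓝 0) := by
    refine tendsto_of_tendsto_of_tendsto_of_le_of_le tendsto_const_nhds ?_ (fun _ => zero_le) hbound
    simpa using (ENNReal.tendsto_sum_nat_add _ hfb).add (ENNReal.tendsto_sum_nat_add _ hfa)
  exact (ENNReal.tendsto_toReal ENNReal.zero_ne_top).comp hlim

theorem kineticSpace_completeSpace (T : H →ₗ.[ℂ] H) :
    letI : NormedAddCommGroup (KineticSpace T) :=
      NormedAddCommGroup.ofCore (kineticSpace_normedSpaceCore T)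
    CompleteSpace (KineticSpace T) := by
  let _ : NormedAddCommGroup (KineticSpace T) :=
    NormedAddCommGroup.ofCore (kineticSpace_normedSpaceCore T)
  refine NormedAddCommGroup.completeSpace_of_summable_imp_tendsto fun u hu => ?_
  obtain ⟨γ, hγ⟩ := exists_tendsto_sum T u hu
  exact ⟨γ, tendsto_iff_norm_sub_tendsto_zero.2 hγ⟩

/-! ### The quotient of `X` by the kernel of the diagonal map -/

section

variable {Ω : Type*} [MeasurableSpace Ω] {μ : Measure Ω} [SigmaFinite μ] (T : H →ₗ.[ℂ] H)
  (P : ProjectionValuedMeasure Ω H) (hP : P.AbsolutelyContinuous μ)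

/-- The algebraic isomorphism `X / ker D ≃ Ξ` induced by the diagonal map. -/
def quotKerEquivDensitySpace :
    (KineticSpace T ⧸ LinearMap.ker (diagonal T P hP)) ≃ₗ[ℝ] DensitySpace T P hP :=
  (diagonal T P hP).quotKerEquivRange

lemma toL1_quotKerEquivDensitySpace (γ : KineticSpace T) :
    DensitySpace.toL1 T P hP (quotKerEquivDensitySpace T P hP (Submodule.Quotient.mk γ)) =
      diagonal T P hP γ := rfl

lemma toL1_injective : Function.Injective (DensitySpace.toL1 T P hP) :=
  Subtype.val_injective

lemma quotKerEquivDensitySpace_eq_iff (γ : KineticSpace T) (ρ : DensitySpace T P hP) :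
    quotKerEquivDensitySpace T P hP (Submodule.Quotient.mk γ) = ρ ↔
      diagonal T P hP γ = DensitySpace.toL1 T P hP ρ := by
  rw [← toL1_quotKerEquivDensitySpace, (toL1_injective T P hP).eq_iff]

lemma densitySpace_norm_lt_iff {ρ : DensitySpace T P hP} {r : ℝ} :
    ‖ρ‖ < r ↔ ∃ γ : KineticSpace T,
      diagonal T P hP γ = DensitySpace.toL1 T P hP ρ ∧ ‖γ‖ < r := by
  have hbdd : BddBelow {r : ℝ | ∃ γ : KineticSpace T,
      diagonal T P hP γ = DensitySpace.toL1 T P hP ρ ∧ r = ‖γ‖} :=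
    ⟨0, by rintro _ ⟨γ, _, rfl⟩; exact (kineticSpace_norm_nonneg T _)⟩
  have hne : {r : ℝ | ∃ γ : KineticSpace T,
      diagonal T P hP γ = DensitySpace.toL1 T P hP ρ ∧ r = ‖γ‖}.Nonempty := by
    obtain ⟨γ, hγ⟩ := ρ.2
    exact ⟨_, γ, hγ, rfl⟩
  change sInf _ < r ↔ _
  rw [csInf_lt_iff hbdd hne]
  constructor
  · rintro ⟨_, ⟨γ, h, rfl⟩, hr⟩
    exact ⟨γ, h, hr⟩
  · rintro ⟨γ, h, hr⟩
    exact ⟨_, ⟨γ, h, rfl⟩, hr⟩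

/-- The integrals of `ρ` are controlled by its norm, since `∫_S D γ = Tr (P(S) γ)`; hence only
`0` has norm `0`. -/
lemma densitySpace_eq_zero_of_norm_eq_zero {ρ : DensitySpace T P hP} (h : ‖ρ‖ = 0) : ρ = 0 := by
  have hint : ∀ S, MeasurableSet S → ∫ x in S, DensitySpace.toL1 T P hP ρ x ∂μ = 0 := by
    intro S hS
    rw [← norm_le_zero_iff]
    refine le_of_forall_pos_lt_add fun ε hε => ?_
    -- The bound `‖P(S)‖ ‖γ‖` is to be less than `ε`; the `1` avoids dividing by `‖P(S)‖ = 0`.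
    have hC : 0 < ‖P.proj S‖ + 1 := by positivity
    obtain ⟨γ, hγ, hlt⟩ := (densitySpace_norm_lt_iff T P hP (ρ := ρ)
      (r := ε / (‖P.proj S‖ + 1))).1 (by rw [h]; positivity)
    have h1 := norm_trace_comp_le T (P.proj S) γ
    rw [← diagonal_spec T P hP γ S hS, Complex.norm_real, hγ] at h1
    rw [lt_div_iff₀ hC] at hlt
    have h2 : 0 ≤ ‖γ‖ := (kineticSpace_norm_nonneg T _)
    nlinarith
  refine toL1_injective T P hP ?_
  rw [map_zero]
  refine Lp.ext ?_
  refine ((L1.integrable_coeFn _).ae_eq_zero_of_forall_setIntegral_eq_zero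
    fun S hS _ => hint S hS).trans (Lp.coeFn_zero _ _ _).symm

/-- The norm of `Ξ` is, by definition, the quotient norm transported by the isomorphism. -/
lemma norm_quotKerEquivDensitySpace :
    letI : NormedAddCommGroup (KineticSpace T) :=
      NormedAddCommGroup.ofCore (kineticSpace_normedSpaceCore T)
    ∀ x : KineticSpace T ⧸ LinearMap.ker (diagonal T P hP),
      ‖quotKerEquivDensitySpace T P hP x‖ = ‖x‖ := by
  let _ : NormedAddCommGroup (KineticSpace T) :=
    NormedAddCommGroup.ofCore (kineticSpace_normedSpaceCore T)
  intro x
  refine eq_of_forall_gt_iff fun r => ?_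
  obtain ⟨γ₀, rfl⟩ := Submodule.Quotient.mk_surjective _ x
  rw [densitySpace_norm_lt_iff]
  refine Iff.trans ?_ QuotientAddGroup.norm_lt_iff.symm
  refine exists_congr fun γ => and_congr_left fun _ => ?_
  rw [← quotKerEquivDensitySpace_eq_iff, (quotKerEquivDensitySpace T P hP).injective.eq_iff]
  rfl

/-- `‖·‖_Ξ` is a norm: it is a seminorm because the quotient norm is one. -/
theorem densitySpace_normedSpaceCore : NormedSpace.Core ℝ (DensitySpace T P hP) := by
  let _ : NormedAddCommGroup (KineticSpace T) :=
    NormedAddCommGroup.ofCore (kineticSpace_normedSpaceCore T)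
  let _ : NormedSpace ℝ (KineticSpace T) :=
    NormedSpace.ofCore (kineticSpace_normedSpaceCore T)
  have hnorm := norm_quotKerEquivDensitySpace T P hP
  have hsurj := (quotKerEquivDensitySpace T P hP).surjective
  refine ⟨⟨fun ρ => ?_, fun c ρ => ?_, fun ρ ρ' => ?_⟩,
    fun ρ => ⟨densitySpace_eq_zero_of_norm_eq_zero T P hP, ?_⟩⟩
  · obtain ⟨x, rfl⟩ := hsurj ρ
    rw [hnorm]
    exact norm_nonneg x
  · obtain ⟨x, rfl⟩ := hsurj ρ
    rw [← map_smul, hnorm, hnorm]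
    exact norm_smul c x
  · obtain ⟨x, rfl⟩ := hsurj ρ
    obtain ⟨y, rfl⟩ := hsurj ρ'
    rw [← map_add, hnorm, hnorm, hnorm]
    exact norm_add_le x y
  · rintro rfl
    rw [← map_zero (quotKerEquivDensitySpace T P hP), hnorm]
    exact norm_zero

end

end

end DensityFunctional

theorem mainTheorem7 {Ω : Type*} [MeasurableSpace Ω] (μ : MeasureTheory.Measure Ω)
    [MeasureTheory.SigmaFinite μ]
    {H : Type*} [NormedAddCommGroup H] [InnerProductSpace ℂ H] [CompleteSpace H]
    [TopologicalSpace.SeparableSpace H]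
    (T : H →ₗ.[ℂ] H) (hT : DensityFunctional.IsPositiveSelfAdjoint T)
    (P : DensityFunctional.ProjectionValuedMeasure Ω H) (hP : P.AbsolutelyContinuous μ) :
    ∃ (hX : NormedSpace.Core ℝ (DensityFunctional.KineticSpace T))
      (hΞ : NormedSpace.Core ℝ (DensityFunctional.DensitySpace T P hP)),
      letI : NormedAddCommGroup (DensityFunctional.KineticSpace T) := NormedAddCommGroup.ofCore hX
      letI : NormedSpace ℝ (DensityFunctional.KineticSpace T) := NormedSpace.ofCore hX
      letI : NormedAddCommGroup (DensityFunctional.DensitySpace T P hP) :=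
        NormedAddCommGroup.ofCore hΞ
      letI : NormedSpace ℝ (DensityFunctional.DensitySpace T P hP) :=
        NormedSpace.ofCore hΞ
      CompleteSpace (DensityFunctional.DensitySpace T P hP) ∧
      ∃ e : (DensityFunctional.KineticSpace T ⧸
            LinearMap.ker (DensityFunctional.diagonal T P hP)) ≃ₗᵢ[ℝ]
          DensityFunctional.DensitySpace T P hP,
        ∀ γ : DensityFunctional.KineticSpace T,
          DensityFunctional.DensitySpace.toL1 T P hP (e (Submodule.Quotient.mk γ)) =
            DensityFunctional.diagonal T P hP γ := by
  refine ⟨DensityFunctional.kineticSpace_normedSpaceCore T,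
    DensityFunctional.densitySpace_normedSpaceCore T P hP, ?_⟩
  let _ : NormedAddCommGroup (DensityFunctional.KineticSpace T) :=
    NormedAddCommGroup.ofCore (DensityFunctional.kineticSpace_normedSpaceCore T)
  let _ : NormedSpace ℝ (DensityFunctional.KineticSpace T) :=
    NormedSpace.ofCore (DensityFunctional.kineticSpace_normedSpaceCore T)
  let _ : NormedAddCommGroup (DensityFunctional.DensitySpace T P hP) :=
    NormedAddCommGroup.ofCore (DensityFunctional.densitySpace_normedSpaceCore T P hP)
  let _ : NormedSpace ℝ (DensityFunctional.DensitySpace T P hP) :=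
    NormedSpace.ofCore (DensityFunctional.densitySpace_normedSpaceCore T P hP)
  let e : (DensityFunctional.KineticSpace T ⧸
      LinearMap.ker (DensityFunctional.diagonal T P hP)) ≃ₗᵢ[ℝ]
      DensityFunctional.DensitySpace T P hP :=
    ⟨DensityFunctional.quotKerEquivDensitySpace T P hP,
      DensityFunctional.norm_quotKerEquivDensitySpace T P hP⟩
  have : CompleteSpace (DensityFunctional.KineticSpace T) :=
    DensityFunctional.kineticSpace_completeSpace T
  exact ⟨e.toIsometryEquiv.completeSpace_iff.1 inferInstance, e,
    DensityFunctional.toL1_quotKerEquivDensitySpace T P hP⟩
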